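/- Let $\Gamma$ be a finite cubic graph (loops and multiple edges allowed). An orientation $\mathcal O$ of $\Gamma$ is a choice, at every vertex, of a cyclic permutation of the three half-edges there; gluing one ideal hyperbolic triangle per vertex according to $(\Gamma,\mathcal O)$, with midpoints of sides glued to midpoints, gives a hyperbolic surface $S^O(\Gamma,\mathcal O)$. A cycle $\mathcal P$ of length $N$ in $\Gamma$ (a closed path through $N$ distinct vertices) turns left or right at each of its vertices, as prescribed by $\mathcal O$. Let $M_{\mathcal P}=W_1\cdots W_N$, where $W_j=\begin{pmatrix}1&1\\0&1\end{pmatrix}$ if the $j$-th turn is to the left and $W_j=\begin{pmatrix}1&0\\1&1\end{pmatrix}$ if it is to the right. The closed geodesic on $S^O(\Gamma,\mathcal O)$ associated to $\mathcal P$ is the one in the free homotopy class given by the deck transformation $M_{\mathcal P}$ of the hyperbolic plane; its length $l$ is the translation length of $M_{\mathcal P}$ (so $l=0$ if all turns are equal). Let $E_N(l)$ be the expected value of $l$ when the orientation is uniformly random (an independent fair coin is tossed at each vertex). Theorem. (1) For every orientation, $l = 2\operatorname{arccosh}\bigl(\tfrac12\operatorname{tr} M_{\mathcal P}\bigr)$.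 (2) Consequently $$E_N(l)=\frac1{2^N}\sum_{W_1,\dots,W_N} 2\operatorname{arccosh}\Bigl(\tfrac12\operatorname{tr}(W_1\cdots W_N)\Bigr),$$ where each $W_j$ runs over the two matrices above; in particular $E_N(l)$ depends only on $N$. (3) For all sufficiently large $N$, $$2(\log 1.43925)\,N\;\le\;E_N(l)\;\le\;2(\log 1.5)\,N .$$ -/

import Mathlib

open Filter

namespace BelyiSurface

/-- A cubic graph on the vertex set `V`, loops and multiple edges allowed: every vertex carries
three half-edges, and the half-edges are matched in pairs, each pair being an edge. -/
structure CubicGraph (V : Type*) where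
  /-- the other half of the edge to which a half-edge belongs -/
  pair : V × Fin 3 → V × Fin 3
  pair_pair : ∀ h, pair (pair h) = h
  pair_ne : ∀ h, pair h ≠ h

/-- An orientation: at every vertex a cyclic permutation of the three half-edges there.  It is
read as the counterclockwise order in which the half-edges leave the vertex. -/
abbrev GraphOrientation (V : Type*) : Type _ :=
  V → {σ : Equiv.Perm (Fin 3) // σ.IsThreeCycle}

/-- A cycle of length `N`: a closed path through `N` distinct vertices.  It comes to `vertex i`
along the half-edge `arrive i`, goes on along a different half-edge `leave i`, and the edge of
the latter leads to the cyclically next vertex. -/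
structure GraphCycle {V : Type*} (Γ : CubicGraph V) (N : ℕ) where
  vertex : Fin N → V
  vertex_injective : Function.Injective vertex
  arrive : Fin N → Fin 3
  leave : Fin N → Fin 3
  arrive_ne_leave : ∀ i, arrive i ≠ leave i
  pair_leave : ∀ i, Γ.pair (vertex i, leave i) =
    (vertex (finRotate N i), arrive (finRotate N i))

/-- The matrix of a left turn. -/
def matL : Matrix.SpecialLinearGroup (Fin 2) ℤ :=
  ⟨!![1, 1; 0, 1], by simp [Matrix.det_fin_two_of]⟩

/-- The matrix of a right turn. -/
def matR : Matrix.SpecialLinearGroup (Fin 2) ℤ :=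
  ⟨!![1, 0; 1, 1], by simp [Matrix.det_fin_two_of]⟩

/-- The product `W₁ ⋯ W_N` of a word of turns; `true` is a left turn, `false` a right turn. -/
def wordMatrix {N : ℕ} (w : Fin N → Bool) : Matrix.SpecialLinearGroup (Fin 2) ℤ :=
  (List.ofFn fun i => if w i then matL else matR).prod

/-- The trace of the product of a word of turns, as a real number. -/
def wordTrace {N : ℕ} (w : Fin N → Bool) : ℝ :=
  ((wordMatrix w : Matrix (Fin 2) (Fin 2) ℤ).trace : ℝ)

/-- The translation length of `g` as an isometry of the hyperbolic plane.  If `g` is a deck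
transformation of a hyperbolic surface covered by the upper half-plane, this is the length of the
closed geodesic in the free homotopy class of `g` (and `0` if `g` is trivial or goes around a
cusp). -/
noncomputable def translationLength (g : Matrix.SpecialLinearGroup (Fin 2) ℤ) : ℝ :=
  ⨅ z : UpperHalfPlane, dist z (g • z)

namespace GraphCycle

variable {V : Type*} {Γ : CubicGraph V} {N : ℕ}

/-- The word of turns which the cycle makes: `true` (left) where the half-edge of departure comes
next clockwise after the half-edge of arrival, `false` (right) where it comes next
counterclockwise. -/
def turns (C : GraphCycle Γ N) (O : GraphOrientation V) (i : Fin N) : Bool :=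
  decide ((O (C.vertex i)).1 (C.leave i) = C.arrive i)

/-- The length of the closed geodesic associated to the cycle, on the surface that is glued from
ideal triangles according to the graph and its orientation; the deck transformation of the cycle
is the product of the matrices of its turns. -/
noncomputable def geodesicLength (C : GraphCycle Γ N) (O : GraphOrientation V) : ℝ :=
  translationLength (wordMatrix (C.turns O))

open Classical in
/-- The expected value of the length of the geodesic associated to the cycle, the orientation of
the graph being uniformly random (a fair coin is tossed at each vertex). -/
noncomputable def expectedLength [Fintype V] (C : GraphCycle Γ N) : ℝ :=
  (∑ O : GraphOrientation V, C.geodesicLength O) / (Fintype.card (GraphOrientation V) : ℝ)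

end GraphCycle

end BelyiSurface

/-! For a unimodular matrix of trace `t ≥ 2`, `cosh` of the displacement of a point is `t ^ 2 / 2 -
1` plus a square with infimum zero; this gives the length formula (`translationLength_eq`). At each
vertex of the cycle exactly one of the two cyclic permutations yields a left turn, and the vertices
are distinct, so all words of turns are equally likely (`exists_equiv_turns`).

The upper bound is Jensen's inequality for `log`: the mean trace is `(3 ^ N + 1) / 2 ^ N`, and the
small excess over `1.5 ^ N` is absorbed by the all-left word, whose length is zero. For the lower
bound the trace is replaced by the sum of all entries, whose mean logarithm grows by at least `log
7200 / 8` per three letters (`sum_log_entrySum_add_three`); a nonconstant prefix brings back the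
trace (`entrySum_le_trace_mul`). -/

namespace BelyiSurface

open Matrix UpperHalfPlane

/-! ### Displacement and translation length -/

/-- The displacement of a point of the hyperbolic plane under a unimodular integer matrix. -/
theorem cosh_dist_smul (g : SpecialLinearGroup (Fin 2) ℤ) (z : ℍ) :
    Real.cosh (dist z (g • z)) =
      ((g : Matrix (Fin 2) (Fin 2) ℤ).trace : ℝ) ^ 2 / 2 - 1 +
        ((g 1 0 : ℝ) * (z.re ^ 2 + z.im ^ 2) + ((g 1 1 : ℝ) - g 0 0) * z.re - g 0 1) ^ 2 /
          (2 * z.im ^ 2) := by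
  have hdet : (g 0 0 : ℝ) * g 1 1 - g 0 1 * g 1 0 = 1 := by
    have := g.det_coe
    rw [Matrix.det_fin_two] at this
    exact_mod_cast this
  have hy := z.im_pos
  have hne : ((g 1 0 : ℝ) : ℂ) * z + ((g 1 1 : ℝ) : ℂ) ≠ 0 := by
    intro h
    have h1 := congrArg Complex.im h
    have h2 := congrArg Complex.re h
    simp [hy.ne'] at h1 h2
    rw [h1] at hdet h2
    simp at h2
    rw [h2] at hdet
    simp at hdet
  have hN : 0 < Complex.normSq (((g 1 0 : ℝ) : ℂ) * z + ((g 1 1 : ℝ) : ℂ)) :=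
    Complex.normSq_pos.2 hne
  have hcoe : ((g • z : ℍ) : ℂ) = (((g 0 0 : ℝ) : ℂ) * z + ((g 0 1 : ℝ) : ℂ)) /
      (((g 1 0 : ℝ) : ℂ) * z + ((g 1 1 : ℝ) : ℂ)) := by
    rw [coe_specialLinearGroup_apply]; simp
  have him : (g • z).im =
      z.im / Complex.normSq (((g 1 0 : ℝ) : ℂ) * z + ((g 1 1 : ℝ) : ℂ)) := by
    rw [ModularGroup.im_smul_eq_div_normSq, ModularGroup.denom_apply]; simp
  have hsub : (z : ℂ) - (g • z : ℍ) = (((g 1 0 : ℝ) : ℂ) * z ^ 2 +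
      (((g 1 1 : ℝ) : ℂ) - ((g 0 0 : ℝ) : ℂ)) * z - ((g 0 1 : ℝ) : ℂ)) /
      (((g 1 0 : ℝ) : ℂ) * z + ((g 1 1 : ℝ) : ℂ)) := by
    rw [hcoe, eq_div_iff hne, sub_mul, div_mul_cancel₀ _ hne]; ring
  -- The fixed-point quadratic has discriminant `t ^ 2 - 4`, which is the coefficient of `z.im ^ 2`;
  -- the other square vanishes exactly on the axis.
  have hQ : Complex.normSq (((g 1 0 : ℝ) : ℂ) * z ^ 2 +
      (((g 1 1 : ℝ) : ℂ) - ((g 0 0 : ℝ) : ℂ)) * z - ((g 0 1 : ℝ) : ℂ)) =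
      z.im ^ 2 * (((g 0 0 : ℝ) + g 1 1) ^ 2 - 4) +
      ((g 1 0 : ℝ) * (z.re ^ 2 + z.im ^ 2) + ((g 1 1 : ℝ) - g 0 0) * z.re - g 0 1) ^ 2 := by
    rw [Complex.normSq_apply]
    simp only [pow_two, Complex.add_re, Complex.sub_re, Complex.mul_re, Complex.add_im,
      Complex.sub_im, Complex.mul_im, Complex.ofReal_re, Complex.ofReal_im, coe_re, coe_im]
    linear_combination (-4 * z.im ^ 2) * hdet
  rw [cosh_dist, Complex.dist_eq, Complex.sq_norm, hsub, Complex.normSq_div, hQ, him,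
    Matrix.trace_fin_two]
  generalize Complex.normSq (((g 1 0 : ℝ) : ℂ) * z + ((g 1 1 : ℝ) : ℂ)) = n at hN ⊢
  push_cast
  field_simp
  ring

theorem translationLength_eq (g : SpecialLinearGroup (Fin 2) ℤ)
    (hg : 2 ≤ (g : Matrix (Fin 2) (Fin 2) ℤ).trace) :
    translationLength g =
      2 * Real.arcosh (((g : Matrix (Fin 2) (Fin 2) ℤ).trace : ℝ) / 2) := by
  have ht : (2 : ℝ) ≤ ((g : Matrix (Fin 2) (Fin 2) ℤ).trace : ℝ) := by exact_mod_cast hg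
  have hd := cosh_dist_smul g
  have htr : ((g : Matrix (Fin 2) (Fin 2) ℤ).trace : ℝ) = (g 0 0 : ℝ) + g 1 1 := by
    rw [Matrix.trace_fin_two]; push_cast; rfl
  set t : ℝ := ((g : Matrix (Fin 2) (Fin 2) ℤ).trace : ℝ) with ht_def
  have hdetZ : g 0 0 * g 1 1 - g 0 1 * g 1 0 = 1 := by
    have := g.det_coe
    rwa [Matrix.det_fin_two] at this
  have hdet : (g 0 0 : ℝ) * g 1 1 - g 0 1 * g 1 0 = 1 := by exact_mod_cast hdetZ
  have hl0 : 0 ≤ 2 * Real.arcosh (t / 2) := by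
    have := Real.arcosh_nonneg (x := t / 2) (by linarith)
    linarith
  have hl : Real.cosh (2 * Real.arcosh (t / 2)) = t ^ 2 / 2 - 1 := by
    rw [Real.cosh_two_mul, Real.sinh_sq, Real.cosh_arcosh (by linarith)]; ring
  have hbdd : BddBelow (Set.range fun z : ℍ => dist z (g • z)) :=
    ⟨0, by rintro _ ⟨z, rfl⟩; exact dist_nonneg⟩
  refine le_antisymm ?_ (le_ciInf fun z => ?_)
  · have h0 : 0 ≤ translationLength g := Real.iInf_nonneg fun z => dist_nonneg
    rw [← abs_of_nonneg h0, ← abs_of_nonneg hl0, ← Real.cosh_le_cosh, hl]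
    -- points of the plane whose displacement is nearly minimal
    suffices h : ∀ ε : ℝ, 0 < ε → ∃ z : ℍ,
        ((g 1 0 : ℝ) * (z.re ^ 2 + z.im ^ 2) + ((g 1 1 : ℝ) - g 0 0) * z.re - g 0 1) ^ 2 /
          (2 * z.im ^ 2) ≤ ε by
      refine le_of_forall_pos_le_add fun ε hε => ?_
      obtain ⟨z, hz⟩ := h ε hε
      have h1 : translationLength g ≤ dist z (g • z) := ciInf_le hbdd z
      have h2 : Real.cosh (translationLength g) ≤ Real.cosh (dist z (g • z)) := by
        rw [Real.cosh_le_cosh, abs_of_nonneg h0, abs_of_nonneg dist_nonneg]; exact h1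
      rw [hd z] at h2
      linarith
    intro ε hε
    by_cases hc : g 1 0 = 0
    · have had : g 0 0 = g 1 1 := by
        rw [hc] at hdetZ
        exact Int.eq_of_mul_eq_one (by linarith)
      -- A translation moves points little high up in the cusp; the `+ 1` keeps the height positive
      -- for the identity.
      have hpos : 0 < |(g 0 1 : ℝ)| / √ε + 1 := by positivity
      refine ⟨⟨⟨0, |(g 0 1 : ℝ)| / √ε + 1⟩, hpos⟩, ?_⟩
      have hre : (⟨⟨0, |(g 0 1 : ℝ)| / √ε + 1⟩, hpos⟩ : ℍ).re = 0 := rfl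
      have him : (⟨⟨0, |(g 0 1 : ℝ)| / √ε + 1⟩, hpos⟩ : ℍ).im = |(g 0 1 : ℝ)| / √ε + 1 := rfl
      rw [hre, him, hc, div_le_iff₀ (by positivity)]
      have h1 : |(g 0 1 : ℝ)| ≤ √ε * (|(g 0 1 : ℝ)| / √ε + 1) := by
        have := Real.sqrt_pos.2 hε
        rw [mul_add, mul_div_cancel₀ _ this.ne']
        linarith
      have h2 := pow_le_pow_left₀ (abs_nonneg _) h1 2
      rw [sq_abs, mul_pow, Real.sq_sqrt hε.le] at h2
      have h3 : 0 ≤ ε * (|(g 0 1 : ℝ)| / √ε + 1) ^ 2 := by positivity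
      push_cast
      nlinarith
    · have hc' : (g 1 0 : ℝ) ≠ 0 := by exact_mod_cast hc
      have hca : 0 < |(g 1 0 : ℝ)| := abs_pos.2 hc'
      set c : ℝ := (g 1 0 : ℝ)
      -- `s` is the radius of the semicircular axis, so the witness lies `δ` above its top. The
      -- shift is needed for `t = 2`, where `s = 0` is a boundary point.
      set s : ℝ := √(t ^ 2 - 4) / (2 * |c|) with hs
      have hs0 : 0 ≤ s := by positivity
      have hs2 : 4 * c ^ 2 * s ^ 2 = t ^ 2 - 4 := by
        rw [hs, div_pow, Real.sq_sqrt (by nlinarith), mul_pow, sq_abs]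
        field_simp
        ring
      set δ : ℝ := √ε / (2 * |c|) with hδ
      have hδ0 : 0 < δ := by have := Real.sqrt_pos.2 hε; positivity
      have hδ2 : 4 * c ^ 2 * δ ^ 2 = ε := by
        rw [hδ, div_pow, Real.sq_sqrt hε.le, mul_pow, sq_abs]
        field_simp
        ring
      have hpos : 0 < s + δ := by positivity
      refine ⟨⟨⟨((g 0 0 : ℝ) - g 1 1) / (2 * c), s + δ⟩, hpos⟩, ?_⟩
      have hre : (⟨⟨((g 0 0 : ℝ) - g 1 1) / (2 * c), s + δ⟩, hpos⟩ : ℍ).re =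
        ((g 0 0 : ℝ) - g 1 1) / (2 * c) := rfl
      have him : (⟨⟨((g 0 0 : ℝ) - g 1 1) / (2 * c), s + δ⟩, hpos⟩ : ℍ).im = s + δ := rfl
      have hK : c * ((((g 0 0 : ℝ) - g 1 1) / (2 * c)) ^ 2 + (s + δ) ^ 2) +
          ((g 1 1 : ℝ) - g 0 0) * (((g 0 0 : ℝ) - g 1 1) / (2 * c)) - g 0 1 =
          c * δ * (2 * s + δ) := by
        have : 4 * c ^ 2 * s ^ 2 = ((g 0 0 : ℝ) + g 1 1) ^ 2 - 4 := by rw [hs2, htr]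
        field_simp
        linear_combination this + 4 * hdet
      rw [hre, him, hK, div_le_iff₀ (by positivity), ← hδ2]
      have h1 : (2 * s + δ) ^ 2 ≤ (2 * (s + δ)) ^ 2 := by
        apply pow_le_pow_left₀ (by positivity); linarith
      have h2 : 0 ≤ c ^ 2 * δ ^ 2 := by positivity
      have h3 : 0 ≤ c ^ 2 * δ ^ 2 * (s + δ) ^ 2 := by positivity
      nlinarith [mul_le_mul_of_nonneg_left h1 h2]
  · rw [← abs_of_nonneg hl0, ← abs_of_nonneg (dist_nonneg (x := z) (y := g • z)),
      ← Real.cosh_le_cosh, hl, hd z]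
    have : 0 ≤ ((g 1 0 : ℝ) * (z.re ^ 2 + z.im ^ 2) +
        ((g 1 1 : ℝ) - g 0 0) * z.re - g 0 1) ^ 2 / (2 * z.im ^ 2) := by positivity
    linarith

/-! ### Products of turn matrices -/

variable {N : ℕ}

theorem wordMatrix_cons (b : Bool) (w : Fin N → Bool) :
    wordMatrix (Fin.cons b w : Fin (N + 1) → Bool) =
      (if b then matL else matR) * wordMatrix w := by
  simp [wordMatrix, List.ofFn_succ]

theorem matL_mul_apply_zero (g : SpecialLinearGroup (Fin 2) ℤ) (j : Fin 2) :
    (matL * g) 0 j = g 0 j + g 1 j := by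
  change ((matL : Matrix (Fin 2) (Fin 2) ℤ) * (g : Matrix (Fin 2) (Fin 2) ℤ)) 0 j = _
  simp [matL, Matrix.mul_apply, Fin.sum_univ_two]

theorem matL_mul_apply_one (g : SpecialLinearGroup (Fin 2) ℤ) (j : Fin 2) :
    (matL * g) 1 j = g 1 j := by
  change ((matL : Matrix (Fin 2) (Fin 2) ℤ) * (g : Matrix (Fin 2) (Fin 2) ℤ)) 1 j = _
  simp [matL, Matrix.mul_apply, Fin.sum_univ_two]

theorem matR_mul_apply_zero (g : SpecialLinearGroup (Fin 2) ℤ) (j : Fin 2) :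
    (matR * g) 0 j = g 0 j := by
  change ((matR : Matrix (Fin 2) (Fin 2) ℤ) * (g : Matrix (Fin 2) (Fin 2) ℤ)) 0 j = _
  simp [matR, Matrix.mul_apply, Fin.sum_univ_two]

theorem matR_mul_apply_one (g : SpecialLinearGroup (Fin 2) ℤ) (j : Fin 2) :
    (matR * g) 1 j = g 0 j + g 1 j := by
  change ((matR : Matrix (Fin 2) (Fin 2) ℤ) * (g : Matrix (Fin 2) (Fin 2) ℤ)) 1 j = _
  simp [matR, Matrix.mul_apply, Fin.sum_univ_two]

theorem wordMatrix_entries (w : Fin N → Bool) :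
    1 ≤ wordMatrix w 0 0 ∧ 0 ≤ wordMatrix w 0 1 ∧ 0 ≤ wordMatrix w 1 0 ∧ 1 ≤ wordMatrix w 1 1 := by
  induction N with
  | zero => simp [wordMatrix]
  | succ N ih =>
    have := ih (Fin.tail w)
    rw [← Fin.cons_self_tail w, wordMatrix_cons]
    cases w 0 <;> simp only [Bool.false_eq_true, if_false, if_true, matL_mul_apply_zero,
      matL_mul_apply_one, matR_mul_apply_zero, matR_mul_apply_one] <;> omega

theorem one_le_wordMatrix_zero_one (w : Fin N → Bool) (i : Fin N) (hi : w i = true) :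
    1 ≤ wordMatrix w 0 1 := by
  induction N with
  | zero => exact i.elim0
  | succ N ih =>
    rw [← Fin.cons_self_tail w, wordMatrix_cons]
    have he := wordMatrix_entries (Fin.tail w)
    cases hb : w 0 with
    | true => simp [matL_mul_apply_zero]; omega
    | false =>
      simp only [Bool.false_eq_true, if_false, matR_mul_apply_zero]
      cases i using Fin.cases with
      | zero => simp [hb] at hi
      | succ i => exact ih _ i hi

theorem one_le_wordMatrix_one_zero (w : Fin N → Bool) (i : Fin N) (hi : w i = false) :
    1 ≤ wordMatrix w 1 0 := by
  induction N with
  | zero => exact i.elim0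
  | succ N ih =>
    rw [← Fin.cons_self_tail w, wordMatrix_cons]
    have he := wordMatrix_entries (Fin.tail w)
    cases hb : w 0 with
    | false => simp [matR_mul_apply_one]; omega
    | true =>
      simp only [if_true, matL_mul_apply_one]
      cases i using Fin.cases with
      | zero => simp [hb] at hi
      | succ i => exact ih _ i hi

theorem wordTrace_eq (w : Fin N → Bool) :
    wordTrace w = (wordMatrix w 0 0 : ℝ) + wordMatrix w 1 1 := by
  rw [wordTrace, Matrix.trace_fin_two]; push_cast; rfl

theorem two_le_trace_wordMatrix (w : Fin N → Bool) :
    2 ≤ (wordMatrix w : Matrix (Fin 2) (Fin 2) ℤ).trace := by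
  have := wordMatrix_entries w
  rw [Matrix.trace_fin_two]
  omega

theorem two_le_wordTrace (w : Fin N → Bool) : 2 ≤ wordTrace w := by
  rw [wordTrace]
  exact_mod_cast two_le_trace_wordMatrix w

theorem geodesicLength_eq {V : Type*} {Γ : CubicGraph V} (C : GraphCycle Γ N)
    (O : GraphOrientation V) :
    C.geodesicLength O = 2 * Real.arcosh (wordTrace (C.turns O) / 2) :=
  translationLength_eq _ (two_le_trace_wordMatrix _)

theorem sum_wordMatrix_succ (f : SpecialLinearGroup (Fin 2) ℤ → ℝ) :
    ∑ w : Fin (N + 1) → Bool, f (wordMatrix w) =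
      ∑ w : Fin N → Bool, (f (matL * wordMatrix w) + f (matR * wordMatrix w)) := by
  rw [← (Fin.consEquiv fun _ : Fin (N + 1) => Bool).sum_comp, Fintype.sum_prod_type,
    Fintype.sum_bool, ← Finset.sum_add_distrib]
  simp [Fin.consEquiv, wordMatrix_cons]

theorem sum_wordMatrix_add (m : ℕ) (f : SpecialLinearGroup (Fin 2) ℤ → ℝ) :
    ∑ w : Fin (N + m) → Bool, f (wordMatrix w) =
      ∑ u : Fin m → Bool, ∑ w : Fin N → Bool, f (wordMatrix u * wordMatrix w) := by
  induction m generalizing f with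
  | zero => simp [wordMatrix]
  | succ m ih =>
    rw [← add_assoc, sum_wordMatrix_succ, ih fun g => f (matL * g) + f (matR * g),
      sum_wordMatrix_succ fun g => ∑ w : Fin N → Bool, f (g * wordMatrix w)]
    simp only [Finset.sum_add_distrib, mul_assoc]

/-! ### Mean trace and upper bound -/

/-- The sum of all products is `(L + R) ^ N`, and `L + R` has eigenvalues `3` and `1`, with
eigenvectors `(1, 1)` and `(1, -1)`. -/
theorem sum_wordTrace (N : ℕ) : ∑ w : Fin N → Bool, wordTrace w = 3 ^ N + 1 := by
  have key (N : ℕ) :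
      ∑ w : Fin N → Bool, ((wordMatrix w 0 0 : ℝ) + wordMatrix w 1 0) = 3 ^ N ∧
      ∑ w : Fin N → Bool, ((wordMatrix w 0 0 : ℝ) - wordMatrix w 1 0) = 1 ∧
      ∑ w : Fin N → Bool, ((wordMatrix w 0 1 : ℝ) + wordMatrix w 1 1) = 3 ^ N ∧
      ∑ w : Fin N → Bool, ((wordMatrix w 1 1 : ℝ) - wordMatrix w 0 1) = 1 := by
    induction N with
    | zero => simp [wordMatrix]
    | succ N ih =>
      obtain ⟨h1, h2, h3, h4⟩ := ih
      refine ⟨?_, ?_, ?_, ?_⟩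
      · rw [sum_wordMatrix_succ fun g => (g 0 0 : ℝ) + g 1 0, pow_succ, ← h1, Finset.sum_mul]
        refine Finset.sum_congr rfl fun w _ => ?_
        simp only [matL_mul_apply_zero, matL_mul_apply_one, matR_mul_apply_zero,
          matR_mul_apply_one]
        push_cast; ring
      · rw [sum_wordMatrix_succ fun g => (g 0 0 : ℝ) - g 1 0, ← h2]
        refine Finset.sum_congr rfl fun w _ => ?_
        simp only [matL_mul_apply_zero, matL_mul_apply_one, matR_mul_apply_zero,
          matR_mul_apply_one]
        push_cast; ring
      · rw [sum_wordMatrix_succ fun g => (g 0 1 : ℝ) + g 1 1, pow_succ, ← h3, Finset.sum_mul]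
        refine Finset.sum_congr rfl fun w _ => ?_
        simp only [matL_mul_apply_zero, matL_mul_apply_one, matR_mul_apply_zero,
          matR_mul_apply_one]
        push_cast; ring
      · rw [sum_wordMatrix_succ fun g => (g 1 1 : ℝ) - g 0 1, ← h4]
        refine Finset.sum_congr rfl fun w _ => ?_
        simp only [matL_mul_apply_zero, matL_mul_apply_one, matR_mul_apply_zero,
          matR_mul_apply_one]
        push_cast; ring
  obtain ⟨h1, h2, h3, h4⟩ := key N
  simp only [wordTrace_eq, Finset.sum_add_distrib, Finset.sum_sub_distrib] at *
  linarith

theorem wordTrace_const_true (N : ℕ) : wordTrace (fun _ : Fin N => true) = 2 := by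
  have h : wordMatrix (fun _ : Fin N => true) 1 0 = 0 ∧
      wordMatrix (fun _ : Fin N => true) 0 0 = 1 ∧
      wordMatrix (fun _ : Fin N => true) 1 1 = 1 := by
    induction N with
    | zero => simp [wordMatrix]
    | succ N ih =>
      have : (fun _ : Fin (N + 1) => true) =
          (Fin.cons true fun _ : Fin N => true : Fin (N + 1) → Bool) := by
        exact (Fin.cons_self_tail fun _ : Fin (N + 1) => true).symm
      rw [this, wordMatrix_cons]
      simp [matL_mul_apply_zero, matL_mul_apply_one, ih]
  rw [wordTrace_eq, h.2.1, h.2.2]; norm_num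

theorem arcosh_le_log_two_mul {x : ℝ} (hx : 1 ≤ x) : Real.arcosh x ≤ Real.log (2 * x) := by
  rw [Real.arcosh]
  refine Real.log_le_log (by positivity) ?_
  have : √(x ^ 2 - 1) ≤ √(x ^ 2) := Real.sqrt_le_sqrt (by linarith)
  rw [Real.sqrt_sq (by linarith)] at this
  linarith

theorem log_le_arcosh {x : ℝ} (hx : 1 ≤ x) : Real.log x ≤ Real.arcosh x :=
  Real.log_le_log (by positivity) (by have := Real.sqrt_nonneg (x ^ 2 - 1); linarith)

theorem sum_arcosh_wordTrace_le (hN : 1 ≤ N) :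
    ∑ w : Fin N → Bool, Real.arcosh (wordTrace w / 2) ≤ 2 ^ N * (N * Real.log 1.5) := by
  have hm : (0 : ℝ) < 1.5 ^ N := by positivity
  -- Tangent line to `log` at `1.5 ^ N`; the all-left word has `arcosh 1 = 0` instead of `log 2`.
  have hpt (w : Fin N → Bool) : Real.arcosh (wordTrace w / 2) ≤
      N * Real.log 1.5 + (wordTrace w / 1.5 ^ N - 1) -
        if w = (fun _ => true) then Real.log 2 else 0 := by
    have ht := two_le_wordTrace w
    have h1 : Real.log (wordTrace w) ≤ N * Real.log 1.5 + (wordTrace w / 1.5 ^ N - 1) := by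
      have := Real.log_le_sub_one_of_pos (x := wordTrace w / 1.5 ^ N) (by positivity)
      rw [Real.log_div (by positivity) hm.ne', Real.log_pow] at this
      linarith
    split_ifs with hw
    · have h2 : wordTrace w = 2 := by rw [hw, wordTrace_const_true]
      rw [h2] at h1 ⊢
      simp only [div_self (two_ne_zero (α := ℝ)), Real.arcosh_zero]
      linarith
    · have h2 := arcosh_le_log_two_mul (x := wordTrace w / 2) (by linarith)
      rw [mul_div_cancel₀ _ two_ne_zero] at h2
      linarith
  refine (Finset.sum_le_sum fun w _ => hpt w).trans ?_
  simp only [Finset.sum_sub_distrib, Finset.sum_add_distrib, ← Finset.sum_div, sum_wordTrace,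
    Finset.sum_ite_eq', Finset.mem_univ, if_true, Finset.sum_const, Finset.card_univ,
    Fintype.card_fun, Fintype.card_bool, Fintype.card_fin, nsmul_eq_mul]
  push_cast
  -- The excess `1.5⁻ᴺ ≤ 2 / 3` is less than the saved `log 2`.
  have h3 : ((3 : ℝ) ^ N + 1) / 1.5 ^ N ≤ 2 ^ N + 2 / 3 := by
    rw [div_le_iff₀ hm, add_mul, ← mul_pow]
    have : (1.5 : ℝ) ^ 1 ≤ 1.5 ^ N := pow_le_pow_right₀ (by norm_num) hN
    norm_num at this ⊢
    linarith
  have := Real.log_two_gt_d9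
  linarith

/-! ### Lower bound by entry sums -/

/-- The sum of the entries of an integer matrix, as a real number. -/
def entrySum (g : SpecialLinearGroup (Fin 2) ℤ) : ℝ :=
  ((g 0 0 : ℝ) + g 0 1) + ((g 1 0 : ℝ) + g 1 1)

theorem two_le_entrySum (w : Fin N → Bool) : 2 ≤ entrySum (wordMatrix w) := by
  have := wordMatrix_entries w
  have h : (2 : ℤ) ≤ (wordMatrix w 0 0 + wordMatrix w 0 1) +
    (wordMatrix w 1 0 + wordMatrix w 1 1) := by omega
  rw [entrySum]
  exact_mod_cast h

/-- The two products differ by `(a - b) ^ 2 * (x * y)`. -/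
theorem log_add_log_swap_ge {a b x y : ℝ} (ha : 0 < a) (hb : 0 < b) (hx : 0 < x) (hy : 0 < y) :
    Real.log (a * b) + 2 * Real.log (x + y) ≤
      Real.log (a * x + b * y) + Real.log (b * x + a * y) := by
  rw [← Real.log_mul (by positivity) (by positivity)]
  have : 2 * Real.log (x + y) = Real.log ((x + y) ^ 2) := by rw [Real.log_pow]; norm_num
  rw [this, ← Real.log_mul (by positivity) (by positivity)]
  refine Real.log_le_log (by positivity) ?_
  have : 0 ≤ (a - b) ^ 2 * (x * y) := by positivity
  nlinarith

/-- With row sums `x`, `y`, a three-letter prefix makes the entry sum `a * x + b * y`, and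
exchanging `L` and `R` swaps `a` and `b`. The four pairs are (1,4), (2,5), (3,5), (3,4), and `7200 =
4 * 10 * 15 * 12`. -/
theorem sum_log_entrySum_add_three (N : ℕ) :
    8 * ∑ w : Fin N → Bool, Real.log (entrySum (wordMatrix w)) + 2 ^ N * Real.log 7200 ≤
      ∑ w : Fin (N + 3) → Bool, Real.log (entrySum (wordMatrix w)) := by
  rw [sum_wordMatrix_succ fun g => Real.log (entrySum g),
    sum_wordMatrix_succ fun g => Real.log (entrySum (matL * g)) + Real.log (entrySum (matR * g)),
    sum_wordMatrix_succ fun g =>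
      Real.log (entrySum (matL * (matL * g))) + Real.log (entrySum (matR * (matL * g))) +
      (Real.log (entrySum (matL * (matR * g))) + Real.log (entrySum (matR * (matR * g))))]
  have hc : (2 : ℝ) ^ N * Real.log 7200 = ∑ w : Fin N → Bool, Real.log 7200 := by simp
  rw [hc, Finset.mul_sum, ← Finset.sum_add_distrib]
  refine Finset.sum_le_sum fun w _ => ?_
  obtain ⟨h00, h01, h10, h11⟩ := wordMatrix_entries w
  have hx : (0 : ℝ) < (wordMatrix w 0 0 : ℝ) + wordMatrix w 0 1 := by
    exact_mod_cast (by omega : 0 < wordMatrix w 0 0 + wordMatrix w 0 1)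
  have hy : (0 : ℝ) < (wordMatrix w 1 0 : ℝ) + wordMatrix w 1 1 := by
    exact_mod_cast (by omega : 0 < wordMatrix w 1 0 + wordMatrix w 1 1)
  simp only [entrySum, matL_mul_apply_zero, matL_mul_apply_one, matR_mul_apply_zero,
    matR_mul_apply_one, Int.cast_add]
  generalize (wordMatrix w 0 0 : ℝ) = a at *
  generalize (wordMatrix w 0 1 : ℝ) = b at *
  generalize (wordMatrix w 1 0 : ℝ) = c at *
  generalize (wordMatrix w 1 1 : ℝ) = d at *
  have h1 := log_add_log_swap_ge (a := 1) (b := 4) (by norm_num) (by norm_num) hx hy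
  have h2 := log_add_log_swap_ge (a := 2) (b := 5) (by norm_num) (by norm_num) hx hy
  have h3 := log_add_log_swap_ge (a := 3) (b := 5) (by norm_num) (by norm_num) hx hy
  have h4 := log_add_log_swap_ge (a := 3) (b := 4) (by norm_num) (by norm_num) hx hy
  have h5 : Real.log 7200 = Real.log (1 * 4) + Real.log (2 * 5) + Real.log (3 * 5) +
      Real.log (3 * 4) := by
    rw [← Real.log_mul (by norm_num) (by norm_num), ← Real.log_mul (by norm_num) (by norm_num),
      ← Real.log_mul (by norm_num) (by norm_num)]
    norm_num
  ring_nf at h1 h2 h3 h4 h5 ⊢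
  linarith

theorem sum_log_entrySum_ge : ∀ N : ℕ,
    2 ^ N * (((N : ℝ) - 2) * (Real.log 7200 / 24)) ≤
      ∑ w : Fin N → Bool, Real.log (entrySum (wordMatrix w))
  -- The shift by `2` makes the bound nonpositive in all three base cases.
  | 0 | 1 | 2 => by
    refine le_trans ?_ (Finset.sum_nonneg fun w _ =>
      Real.log_nonneg (by have := two_le_entrySum w; linarith))
    have : 0 ≤ Real.log 7200 := Real.log_nonneg (by norm_num)
    norm_num <;> linarith
  | N + 3 => by
    refine le_trans ?_ (sum_log_entrySum_add_three N)
    have := sum_log_entrySum_ge N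
    push_cast
    ring_nf at this ⊢
    linarith

/-- A word with both letters has all four entries at least `1`, so each entry of the second factor
is counted in the trace. -/
theorem entrySum_le_trace_mul {m : ℕ} (u : Fin m → Bool) (hu : u ≠ fun _ => true)
    (hu' : u ≠ fun _ => false) (w : Fin N → Bool) :
    entrySum (wordMatrix w) ≤
      ((wordMatrix u * wordMatrix w : SpecialLinearGroup (Fin 2) ℤ) :
        Matrix (Fin 2) (Fin 2) ℤ).trace := by
  obtain ⟨i, hi⟩ := Function.ne_iff.1 hu
  obtain ⟨j, hj⟩ := Function.ne_iff.1 hu'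
  have h01 := one_le_wordMatrix_zero_one u j (by simpa using hj)
  have h10 := one_le_wordMatrix_one_zero u i (by simpa using hi)
  obtain ⟨h00, -, -, h11⟩ := wordMatrix_entries u
  obtain ⟨k00, k01, k10, k11⟩ := wordMatrix_entries w
  have : (wordMatrix w 0 0 + wordMatrix w 0 1) + (wordMatrix w 1 0 + wordMatrix w 1 1) ≤
      ((wordMatrix u * wordMatrix w : SpecialLinearGroup (Fin 2) ℤ) :
        Matrix (Fin 2) (Fin 2) ℤ).trace := by
    change _ ≤ ((wordMatrix u : Matrix (Fin 2) (Fin 2) ℤ) *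
      (wordMatrix w : Matrix (Fin 2) (Fin 2) ℤ)).trace
    rw [Matrix.trace_fin_two, Matrix.mul_apply, Matrix.mul_apply,
      Fin.sum_univ_two, Fin.sum_univ_two]
    have e1 := le_mul_of_one_le_left (by omega : 0 ≤ wordMatrix w 0 0) h00
    have e2 := le_mul_of_one_le_left k10 h01
    have e3 := le_mul_of_one_le_left k01 h10
    have e4 := le_mul_of_one_le_left (by omega : 0 ≤ wordMatrix w 1 1) h11
    linarith
  rw [entrySum]
  exact_mod_cast this

theorem sum_log_wordTrace_ge {m : ℕ} (hm : 1 ≤ m) (N : ℕ) :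
    (2 ^ m - 2) * ∑ w : Fin N → Bool, Real.log (entrySum (wordMatrix w)) ≤
      ∑ w : Fin (N + m) → Bool, Real.log (wordTrace w) := by
  have hne : (fun _ : Fin m => true) ≠ fun _ => false := fun h => by
    simpa using congrFun h ⟨0, hm⟩
  set S : Finset (Fin m → Bool) := {fun _ => true, fun _ => false}ᶜ with hS
  have hcard : (S.card : ℝ) = 2 ^ m - 2 := by
    have h := Finset.card_add_card_compl
      ({fun _ => true, fun _ => false} : Finset (Fin m → Bool))
    rw [Finset.card_pair hne, ← hS] at h
    simp only [Fintype.card_fun, Fintype.card_bool, Fintype.card_fin] at h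
    have h' : (2 : ℝ) + S.card = 2 ^ m := by exact_mod_cast h
    linarith
  have hsplit := sum_wordMatrix_add (N := N) m fun g =>
    Real.log (((g : Matrix (Fin 2) (Fin 2) ℤ).trace : ℤ) : ℝ)
  simp only [wordTrace]
  rw [hsplit, ← hcard, ← nsmul_eq_mul, ← Finset.sum_const]
  refine (Finset.sum_le_sum fun u hu => ?_).trans
    (Finset.sum_le_sum_of_subset_of_nonneg (Finset.subset_univ S) fun u _ _ => ?_)
  · rw [hS, Finset.mem_compl, Finset.mem_insert, Finset.mem_singleton, not_or] at hu
    refine Finset.sum_le_sum fun w _ => Real.log_le_log ?_ (entrySum_le_trace_mul u hu.1 hu.2 w)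
    have := two_le_entrySum w
    linarith
  · exact Finset.sum_nonneg fun w _ => Real.log_intCast_nonneg _

theorem eventually_le_sum_arcosh_wordTrace : ∀ᶠ N : ℕ in atTop,
    -- Prefixes of length `8` are used: discarding the two constant ones costs the factor `254 / 256
    -- = 127 / 128`. The integer `6245` lies between `1.43925 ^ 24` and `7200 ^ (127 / 128)`,
    -- leaving the slack `η` per letter to absorb the bounded losses.
    2 ^ N * (N * Real.log 1.43925) ≤ ∑ w : Fin N → Bool, Real.arcosh (wordTrace w / 2) := by
  have h1 : 128 * Real.log 6245 ≤ 127 * Real.log 7200 := by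
    have := Real.log_le_log (x := 6245 ^ 128) (y := 7200 ^ 127) (by norm_num) (by norm_num)
    rw [Real.log_pow, Real.log_pow] at this
    exact_mod_cast this
  have h2 : 24 * Real.log 1.43925 < Real.log 6245 := by
    have := Real.log_lt_log (x := 1.43925 ^ 24) (y := 6245) (by norm_num) (by norm_num)
    rw [Real.log_pow] at this
    exact_mod_cast this
  set l := Real.log 1.43925
  set η := Real.log 6245 / 24 - l with hη
  have hη0 : 0 < η := by linarith
  have hlarge : ∀ᶠ N : ℕ in atTop, (10 * (l + η) + Real.log 2) / η ≤ N :=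
    tendsto_natCast_atTop_atTop.eventually_ge_atTop _
  filter_upwards [hlarge, eventually_ge_atTop 10] with N hN hN10
  obtain ⟨n, rfl⟩ : ∃ n, N = n + 8 := ⟨N - 8, by omega⟩
  rw [div_le_iff₀ hη0] at hN
  have hn : (2 : ℝ) ≤ n := by exact_mod_cast (by omega : 2 ≤ n)
  have h3 : ∑ w : Fin (n + 8) → Bool, (Real.log (wordTrace w) - Real.log 2) ≤
      ∑ w : Fin (n + 8) → Bool, Real.arcosh (wordTrace w / 2) := by
    refine Finset.sum_le_sum fun w _ => ?_
    have := two_le_wordTrace w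
    rw [← Real.log_div (by positivity) (by norm_num)]
    exact log_le_arcosh (by linarith)
  refine le_trans ?_ h3
  rw [Finset.sum_sub_distrib]
  have h4 := sum_log_wordTrace_ge (m := 8) (by norm_num) n
  have h5 := sum_log_entrySum_ge n
  have h6 : ∑ w : Fin (n + 8) → Bool, Real.log 2 = 2 ^ (n + 8) * Real.log 2 := by simp
  rw [h6]
  have h7 : ((n : ℝ) + 8) * l ≤
      127 / 128 * (((n : ℝ) - 2) * (Real.log 7200 / 24)) - Real.log 2 := by
    have : ((n : ℝ) - 2) * (l + η) ≤ ((n : ℝ) - 2) * (127 / 128 * (Real.log 7200 / 24)) :=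
      mul_le_mul_of_nonneg_left (by linarith) (by linarith)
    push_cast at hN
    linarith
  have h8 := mul_le_mul_of_nonneg_left h7 (by positivity : (0 : ℝ) ≤ 2 ^ (n + 8))
  rw [pow_add] at h8 ⊢
  push_cast
  linarith

/-! ### Averaging over orientations -/

/-- The two 3-cycles are mutually inverse and send `l` to the two other half-edges, one of which is
`a`. -/
theorem decide_apply_eq_bijective {a l : Fin 3} (h : a ≠ l) :
    Function.Bijective fun σ : {σ : Equiv.Perm (Fin 3) // σ.IsThreeCycle} =>
      decide (σ.1 l = a) := by
  have key : ∀ (a l : Fin 3), a ≠ l →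
      (∀ σ τ : Equiv.Perm (Fin 3), σ.cycleType = {3} → τ.cycleType = {3} →
        decide (σ l = a) = decide (τ l = a) → σ = τ) ∧
      ∀ b : Bool, ∃ σ : Equiv.Perm (Fin 3), σ.cycleType = {3} ∧ decide (σ l = a) = b := by
    decide +kernel
  obtain ⟨h1, h2⟩ := key a l h
  refine ⟨fun σ τ hst => Subtype.ext (h1 _ _ σ.2 τ.2 hst), fun b => ?_⟩
  obtain ⟨σ, hσ, hb⟩ := h2 b
  exact ⟨⟨σ, hσ⟩, hb⟩

/-- An orientation amounts to the word of turns of a given cycle together with an orientation at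
the other vertices. -/
theorem exists_equiv_turns {V : Type*} {Γ : CubicGraph V} (C : GraphCycle Γ N) :
    ∃ e : GraphOrientation V ≃ (Fin N → Bool) × ({v // v ∉ Set.range C.vertex} →
      {σ : Equiv.Perm (Fin 3) // σ.IsThreeCycle}), ∀ O, (e O).1 = C.turns O := by
  classical
  refine ⟨(Equiv.piEquivPiSubtypeProd (· ∈ Set.range C.vertex) _).trans
    (Equiv.prodCongr ((Equiv.arrowCongr (Equiv.ofInjective _ C.vertex_injective).symm
      (Equiv.refl _)).trans (Equiv.piCongrRight fun i =>
        Equiv.ofBijective _ (decide_apply_eq_bijective (C.arrive_ne_leave i))))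
      (Equiv.refl _)), fun O => rfl⟩

theorem expectedLength_eq {V : Type*} [Fintype V] {Γ : CubicGraph V} (C : GraphCycle Γ N) :
    C.expectedLength =
      (∑ w : Fin N → Bool, 2 * Real.arcosh (wordTrace w / 2)) / 2 ^ N := by
  classical
  obtain ⟨e, he⟩ := exists_equiv_turns C
  have hpos : 0 < Fintype.card ({v // v ∉ Set.range C.vertex} →
      {σ : Equiv.Perm (Fin 3) // σ.IsThreeCycle}) :=
    Fintype.card_pos_iff.2
      ⟨fun _ => ((decide_apply_eq_bijective (a := 0) (l := 1) (by decide)).2 true).choose⟩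
  have hcard := Fintype.card_congr e
  have hword : Fintype.card (Fin N → Bool) = 2 ^ N := by simp
  rw [Fintype.card_prod, hword] at hcard
  have hsum : ∑ O : GraphOrientation V, C.geodesicLength O =
      Fintype.card ({v // v ∉ Set.range C.vertex} →
        {σ : Equiv.Perm (Fin 3) // σ.IsThreeCycle}) *
        ∑ w : Fin N → Bool, 2 * Real.arcosh (wordTrace w / 2) := by
    simp only [geodesicLength_eq, ← he]
    rw [e.sum_comp fun p => 2 * Real.arcosh (wordTrace p.1 / 2), Fintype.sum_prod_type,
      Finset.mul_sum]
    simp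
  rw [GraphCycle.expectedLength]
  convert_to (∑ O : GraphOrientation V, C.geodesicLength O) /
    (Fintype.card (GraphOrientation V) : ℝ) = _
  rw [hsum, hcard]
  have : (Fintype.card ({v // v ∉ Set.range C.vertex} →
      {σ : Equiv.Perm (Fin 3) // σ.IsThreeCycle}) : ℝ) ≠ 0 := by exact_mod_cast hpos.ne'
  push_cast
  rw [mul_comm, mul_div_mul_right _ _ this]

end BelyiSurface

theorem mainTheorem3 :
    -- the length of the geodesic of a cycle, for every orientation
    (∀ (V : Type*) (Γ : BelyiSurface.CubicGraph V) (N : ℕ) (C : BelyiSurface.GraphCycle Γ N)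
        (O : BelyiSurface.GraphOrientation V),
      C.geodesicLength O = 2 * Real.arcosh (BelyiSurface.wordTrace (C.turns O) / 2)) ∧
    -- the mean over the orientations is the mean over all products of `N` matrices
    (∀ (V : Type*) [Fintype V] (Γ : BelyiSurface.CubicGraph V) (N : ℕ)
        (C : BelyiSurface.GraphCycle Γ N),
      C.expectedLength =
        (∑ w : Fin N → Bool, 2 * Real.arcosh (BelyiSurface.wordTrace w / 2)) / 2 ^ N) ∧
    -- linear growth, uniformly in the graph and the cycle
    (∀ᶠ N : ℕ in atTop, ∀ (V : Type*) [Fintype V] (Γ : BelyiSurface.CubicGraph V)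
        (C : BelyiSurface.GraphCycle Γ N),
      2 * Real.log 1.43925 * N ≤ C.expectedLength ∧
        C.expectedLength ≤ 2 * Real.log 1.5 * N) := by
  refine ⟨fun V Γ N C O => BelyiSurface.geodesicLength_eq C O,
    fun V _ Γ N C => BelyiSurface.expectedLength_eq C, ?_⟩
  filter_upwards [BelyiSurface.eventually_le_sum_arcosh_wordTrace, eventually_ge_atTop 1]
    with N hN hN1 V _ Γ C
  have hupper := BelyiSurface.sum_arcosh_wordTrace_le hN1
  rw [BelyiSurface.expectedLength_eq, ← Finset.mul_sum, le_div_iff₀ (by positivity),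
    div_le_iff₀ (by positivity)]
  constructor <;> linarith
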